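/- Let $\mathcal C$ be a Grothendieck category. Its spectral category $\mathrm{Spec}\text{-}\mathcal C$ has the same objects as $\mathcal C$ and $\mathrm{Hom}_{\mathrm{Spec}\text{-}\mathcal C}(A,B)=\varinjlim \mathrm{Hom}_{\mathcal C}(A',B)$, the direct limit being taken over the downwards directed family of essential subobjects $A'$ of $A$; let $P\colon\mathcal C\to\mathrm{Spec}\text{-}\mathcal C$ be the canonical functor, which is the identity on objects and sends $f\colon A\to B$ to its class. A ring morphism $\varphi\colon R\to S$ (not necessarily commutative, unital rings) is called local if, for every $r\in R$, $r$ is invertible in $R$ whenever $\varphi(r)$ is invertible in $S$. **Theorem.** (a) Let $A$ be an object of $\mathcal C$, let $\iota\colon A\to L_0$ be an injective envelope of $A$ (an essential monomorphism into an injective object), and let $0\to A\xrightarrow{\iota} L_0\xrightarrow{\pi} L_1\to 0$ be exact, so that $L_1\cong L_0/A$. Every $f\in\mathrm{End}_{\mathcal C}(A)$ extends to some $f_0\in\mathrm{End}_{\mathcal C}(L_0)$ (that is, $f_0\iota=\iota f$), and every such $f_0$ induces a unique $f_1\in\mathrm{End}_{\mathcal C}(L_1)$ with $f_1\pi=\pi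 f_0$. The rule $f\mapsto (P(f),P(f_1))$ does not depend on the choice of $f_0$ and defines a ring morphism $$\chi\colon \mathrm{End}_{\mathcal C}(A)\to \mathrm{End}_{\mathrm{Spec}\text{-}\mathcal C}(A)\times\mathrm{End}_{\mathrm{Spec}\text{-}\mathcal C}(L_1),$$ and $\chi$ is local. (b) For every ring $R$ there exists a local morphism from $R$ into some von Neumann regular right self-injective ring $S$ (that is, for each $a\in S$ there is $b\in S$ with $aba=a$, and $S$ is injective as a right $S$-module). -/

import Mathlib

open CategoryTheory CategoryTheory.Limits

universe w v u x

namespace SpectralTheory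

section Essential

variable {C : Type u} [Category.{v} C] [Abelian C]

/-- A subobject `L` of `A` is essential if it meets every nonzero subobject of `A` nontrivially. -/
def IsEssentialSubobject {A : C} (L : Subobject A) : Prop :=
  ∀ K : Subobject A, K ⊓ L = ⊥ → K = ⊥

/-- An essential monomorphism: a monomorphism whose image is an essential subobject. -/
def IsEssentialMono {X A : C} (s : X ⟶ A) : Prop :=
  ∃ _ : Mono s, IsEssentialSubobject (Subobject.mk s)

/-- `ι : A ⟶ L` exhibits `L` as an injective envelope (injective hull) of `A`. -/
structure IsInjectiveEnvelope {A L : C} (ι : A ⟶ L) : Prop where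
  injective : Injective L
  essential : IsEssentialMono ι

theorem isEssentialMono_iff {X A : C} (s : X ⟶ A) :
    IsEssentialMono s ↔ Mono s ∧ ∀ (Z : C) (h : Z ⟶ A), h ≠ 0 →
      ∃ (W : C) (p : W ⟶ Z) (t : W ⟶ X), p ≫ h = t ≫ s ∧ p ≫ h ≠ 0 := by
  constructor
  · rintro ⟨hs, he⟩
    refine ⟨hs, fun Z h hh => ?_⟩
    have hK : imageSubobject h ≠ ⊥ := by
      intro hb
      apply hh
      rw [← Subobject.bot_factors_iff_zero, ← hb]
      exact (Subobject.factors_iff _ _).2 ⟨_, imageSubobject_arrow_comp h⟩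
    have hI : imageSubobject h ⊓ Subobject.mk s ≠ ⊥ := fun h' => hK (he _ h')
    let I := imageSubobject h ⊓ Subobject.mk s
    let j := Subobject.ofLE I _ (inf_le_left : I ≤ imageSubobject h)
    let k := Subobject.ofLE I _ (inf_le_right : I ≤ Subobject.mk s)
    let p := pullback.fst (factorThruImageSubobject h) j
    let q := pullback.snd (factorThruImageSubobject h) j
    have hp : p ≫ h = q ≫ I.arrow := by
      calc p ≫ h = (p ≫ factorThruImageSubobject h) ≫ (imageSubobject h).arrow := by
            rw [Category.assoc, imageSubobject_arrow_comp]
        _ = (q ≫ j) ≫ (imageSubobject h).arrow := by rw [pullback.condition]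
        _ = q ≫ I.arrow := by rw [Category.assoc, Subobject.ofLE_arrow]
    refine ⟨_, p, q ≫ k ≫ (Subobject.underlyingIso s).hom, ?_, ?_⟩
    · rw [hp, Category.assoc, Category.assoc, Subobject.underlyingIso_hom_comp_eq_mk,
        Subobject.ofLE_arrow]
    · rw [hp]
      intro h0
      have : I.arrow = 0 := by
        rw [← cancel_epi q, h0, comp_zero]
      apply hI
      have h1 := (Subobject.mk_eq_bot_iff_zero (f := I.arrow)).2 this
      rwa [Subobject.mk_arrow] at h1
  · rintro ⟨hs, he⟩
    refine ⟨hs, fun K hK => ?_⟩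
    by_contra hne
    have hK0 : K.arrow ≠ 0 := by
      intro h0
      have h1 := (Subobject.mk_eq_bot_iff_zero (f := K.arrow)).2 h0
      rw [Subobject.mk_arrow] at h1
      exact hne h1
    obtain ⟨W, p, t, h1, h2⟩ := he _ K.arrow hK0
    apply h2
    rw [← Subobject.bot_factors_iff_zero, ← hK, Subobject.inf_factors]
    refine ⟨Subobject.factors_comp_arrow p, ?_⟩
    rw [h1, Subobject.mk_factors_iff]
    exact ⟨t, rfl⟩

theorem IsEssentialMono.mono {X A : C} {s : X ⟶ A} (hs : IsEssentialMono s) : Mono s := hs.1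

theorem IsEssentialMono.id (A : C) : IsEssentialMono (𝟙 A) :=
  (isEssentialMono_iff _).2 ⟨inferInstance, fun Z h hh => ⟨Z, 𝟙 Z, h, by simp, by simpa⟩⟩

theorem IsEssentialMono.comp {X Y A : C} {s : X ⟶ Y} {t : Y ⟶ A}
    (hs : IsEssentialMono s) (ht : IsEssentialMono t) : IsEssentialMono (s ≫ t) := by
  rw [isEssentialMono_iff] at hs ht ⊢
  obtain ⟨ms, hs⟩ := hs
  obtain ⟨mt, ht⟩ := ht
  refine ⟨mono_comp _ _, fun Z h hh => ?_⟩
  obtain ⟨W, p, q, h1, h2⟩ := ht Z h hh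
  have hq : q ≠ 0 := by
    rintro rfl
    exact h2 (by rw [h1, zero_comp])
  obtain ⟨V, a, b, h3, h4⟩ := hs W q hq
  refine ⟨V, a ≫ p, b, ?_, ?_⟩
  · rw [Category.assoc, h1, ← Category.assoc, h3, Category.assoc]
  · rw [Category.assoc, h1, ← Category.assoc]
    intro h0
    exact h4 ((cancel_mono t).1 (by rw [h0, zero_comp]))

/-- The inverse image of an essential subobject under an arbitrary morphism is essential. -/
theorem IsEssentialMono.pullback_fst {X Y B : C} (f : X ⟶ B) {t : Y ⟶ B}
    (ht : IsEssentialMono t) : IsEssentialMono (pullback.fst f t) := by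
  rw [isEssentialMono_iff] at ht ⊢
  obtain ⟨mt, ht⟩ := ht
  refine ⟨inferInstance, fun Z h hh => ?_⟩
  by_cases h0 : h ≫ f = 0
  · exact ⟨Z, 𝟙 Z, pullback.lift h 0 (by rw [h0, zero_comp]),
      by rw [pullback.lift_fst, Category.id_comp], by simpa⟩
  · obtain ⟨W, p, q, h1, h2⟩ := ht Z (h ≫ f) h0
    refine ⟨W, p, pullback.lift (p ≫ h) q (by simpa using h1),
      by rw [pullback.lift_fst], ?_⟩
    intro h3
    apply h2
    rw [← Category.assoc, h3, zero_comp]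

theorem isEssentialMono_arrow {A : C} {L : Subobject A} (hL : IsEssentialSubobject L) :
    IsEssentialMono L.arrow :=
  ⟨inferInstance, by rwa [Subobject.mk_arrow]⟩

/-- The essential subobjects of `A`, the index set of the direct limit below. -/
structure EssIndex (A : C) where
  /-- the underlying subobject -/
  sub : Subobject A
  essential : IsEssentialSubobject sub

/-- Essential subobjects are ordered by reverse inclusion. -/
instance (A : C) : Preorder (EssIndex A) where
  le i j := j.sub ≤ i.sub
  le_refl i := le_refl i.sub
  le_trans _ _ _ h h' := le_trans h' h

theorem EssIndex.le_iff {A : C} {i j : EssIndex A} : i ≤ j ↔ j.sub ≤ i.sub := Iff.rfl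

theorem EssIndex.arrow_essential {A : C} (i : EssIndex A) : IsEssentialMono i.sub.arrow :=
  isEssentialMono_arrow i.essential

/-- The index given by an essential monomorphism. -/
noncomputable def EssIndex.ofMono {X A : C} (s : X ⟶ A) (hs : IsEssentialMono s) : EssIndex A :=
  haveI := hs.1
  { sub := Subobject.mk s, essential := hs.2 }

/-- The canonical isomorphism from the subobject defined by `s : X ⟶ A` to `X`. -/
noncomputable def EssIndex.toDomain {X A : C} (s : X ⟶ A) (hs : IsEssentialMono s) :
    ((EssIndex.ofMono s hs).sub : C) ⟶ X :=
  haveI := hs.1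
  (Subobject.underlyingIso s).hom

theorem EssIndex.toDomain_comp {X A : C} (s : X ⟶ A) (hs : IsEssentialMono s) :
    EssIndex.toDomain s hs ≫ s = (EssIndex.ofMono s hs).sub.arrow :=
  haveI := hs.1
  Subobject.underlyingIso_hom_comp_eq_mk s

theorem EssIndex.le_ofMono {X A : C} (i : EssIndex A) (s : X ⟶ A) (hs : IsEssentialMono s)
    (a : X ⟶ (i.sub : C)) (h : a ≫ i.sub.arrow = s) : i ≤ EssIndex.ofMono s hs :=
  haveI := hs.1
  Subobject.mk_le_of_comm a h

theorem EssIndex.ofMono_le {X A : C} (i : EssIndex A) (s : X ⟶ A) (hs : IsEssentialMono s)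
    (a : (i.sub : C) ⟶ X) (h : a ≫ s = i.sub.arrow) : EssIndex.ofMono s hs ≤ i :=
  haveI := hs.1
  Subobject.le_mk_of_comm a h

instance (A : C) : Nonempty (EssIndex A) := ⟨EssIndex.ofMono (𝟙 A) (IsEssentialMono.id A)⟩

instance (A : C) : IsDirectedOrder (EssIndex A) where
  directed i j :=
    ⟨EssIndex.ofMono _
        ((IsEssentialMono.pullback_fst i.sub.arrow j.arrow_essential).comp i.arrow_essential),
      EssIndex.le_ofMono _ _ _ (pullback.fst i.sub.arrow j.sub.arrow) rfl,
      EssIndex.le_ofMono _ _ _ (pullback.snd i.sub.arrow j.sub.arrow) pullback.condition.symm⟩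

/-- The inclusion between two essential subobjects. -/
noncomputable def EssIndex.incl {A : C} {i j : EssIndex A} (h : i ≤ j) :
    (j.sub : C) ⟶ (i.sub : C) :=
  Subobject.ofLE j.sub i.sub (EssIndex.le_iff.1 h)

theorem EssIndex.incl_arrow {A : C} {i j : EssIndex A} (h : i ≤ j) :
    EssIndex.incl h ≫ i.sub.arrow = j.sub.arrow :=
  Subobject.ofLE_arrow _

/-- For essential subobjects `A'' ≤ A'` of `A`, the restriction map
`Hom(A', B) → Hom(A'', B)`. -/
noncomputable def restrict (A B : C) (i j : EssIndex A) (h : i ≤ j) :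
    ((i.sub : C) ⟶ B) →+ ((j.sub : C) ⟶ B) where
  toFun f := EssIndex.incl h ≫ f
  map_zero' := comp_zero
  map_add' _ _ := Preadditive.comp_add _ _ _ _ _ _

theorem restrict_apply {A B : C} {i j : EssIndex A} (h : i ≤ j) (f : (i.sub : C) ⟶ B) :
    restrict A B i j h f = EssIndex.incl h ≫ f := rfl

instance (A B : C) :
    DirectedSystem (fun i : EssIndex A => ((i.sub : C) ⟶ B)) (restrict A B · · ·) where
  map_self i f := by
    have : EssIndex.incl (le_refl i) = 𝟙 _ := by
      rw [← cancel_mono i.sub.arrow, EssIndex.incl_arrow, Category.id_comp]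
    rw [restrict_apply, this, Category.id_comp]
  map_map i j k hij hjk f := by
    rw [restrict_apply, restrict_apply, restrict_apply, ← Category.assoc]
    congr 1
    rw [← cancel_mono k.sub.arrow, Category.assoc, EssIndex.incl_arrow, EssIndex.incl_arrow,
      EssIndex.incl_arrow]

/-- `Hom(A, B)` in the spectral category: the direct limit of the groups `Hom(A', B)`, where `A'`
runs over the downwards directed family of essential subobjects of `A`. -/
abbrev SpecHom (A B : C) : Type (max u v) :=
  DirectLimit (fun i : EssIndex A => ((i.sub : C) ⟶ B)) (restrict A B)

/-- The class in `SpecHom A B` of a morphism `f : X ⟶ B` defined on an essential subobject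
`s : X ⟶ A`. -/
noncomputable def SpecHom.mk {X A B : C} (s : X ⟶ A) (hs : IsEssentialMono s) (f : X ⟶ B) :
    SpecHom A B :=
  Quotient.mk _ ⟨EssIndex.ofMono s hs, EssIndex.toDomain s hs ≫ f⟩

theorem SpecHom.mk_arrow {A B : C} (i : EssIndex A) (f : (i.sub : C) ⟶ B) :
    SpecHom.mk i.sub.arrow i.arrow_essential f = Quotient.mk _ ⟨i, f⟩ := by
  have h : i ≤ EssIndex.ofMono i.sub.arrow i.arrow_essential :=
    EssIndex.le_ofMono _ _ _ (𝟙 _) (Category.id_comp _)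
  refine Quotient.sound ⟨_, le_rfl, h, ?_⟩
  rw [restrict_apply, restrict_apply, ← Category.assoc]
  congr 1
  rw [← cancel_mono i.sub.arrow, Category.assoc, EssIndex.toDomain_comp, EssIndex.incl_arrow,
    EssIndex.incl_arrow]

theorem SpecHom.exists_mk {A B : C} (φ : SpecHom A B) :
    ∃ (X : C) (s : X ⟶ A) (hs : IsEssentialMono s) (f : X ⟶ B), φ = SpecHom.mk s hs f := by
  obtain ⟨i, f, rfl⟩ := DirectLimit.exists_eq_mk _ φ
  exact ⟨_, _, _, f, (SpecHom.mk_arrow i f).symm⟩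

theorem SpecHom.mk_congr {X A B : C} {s t : X ⟶ A} {f g : X ⟶ B} (hs : IsEssentialMono s)
    (ht : IsEssentialMono t) (hst : s = t) (hfg : f = g) :
    SpecHom.mk s hs f = SpecHom.mk t ht g := by
  subst hst hfg
  rfl

/-- Two morphisms defined on essential subobjects of `A` have the same class if and only if they
agree on a smaller essential subobject. -/
theorem SpecHom.mk_eq_mk_iff {X Y A B : C} {s : X ⟶ A} (hs : IsEssentialMono s) (f : X ⟶ B)
    {t : Y ⟶ A} (ht : IsEssentialMono t) (g : Y ⟶ B) :
    SpecHom.mk s hs f = SpecHom.mk t ht g ↔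
      ∃ (Z : C) (a : Z ⟶ X) (b : Z ⟶ Y), IsEssentialMono (a ≫ s) ∧ a ≫ s = b ≫ t ∧
        a ≫ f = b ≫ g := by
  constructor
  · intro h
    obtain ⟨k, hk1, hk2, hk⟩ := Quotient.exact h
    rw [restrict_apply, restrict_apply, ← Category.assoc, ← Category.assoc] at hk
    have e1 : (EssIndex.incl hk1 ≫ EssIndex.toDomain s hs) ≫ s = k.sub.arrow := by
      rw [Category.assoc, EssIndex.toDomain_comp, EssIndex.incl_arrow]
    have e2 : (EssIndex.incl hk2 ≫ EssIndex.toDomain t ht) ≫ t = k.sub.arrow := by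
      rw [Category.assoc, EssIndex.toDomain_comp, EssIndex.incl_arrow]
    exact ⟨(k.sub : C), _, _, e1 ▸ k.arrow_essential, e1.trans e2.symm, hk⟩
  · rintro ⟨Z, a, b, h1, h2, h3⟩
    have := hs.1
    have := ht.1
    have e1 := EssIndex.toDomain_comp (a ≫ s) h1
    have k1 : EssIndex.ofMono s hs ≤ EssIndex.ofMono (a ≫ s) h1 :=
      EssIndex.ofMono_le _ s hs (EssIndex.toDomain (a ≫ s) h1 ≫ a) (by rw [Category.assoc, e1])
    have k2 : EssIndex.ofMono t ht ≤ EssIndex.ofMono (a ≫ s) h1 :=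
      EssIndex.ofMono_le _ t ht (EssIndex.toDomain (a ≫ s) h1 ≫ b)
        (by rw [Category.assoc, ← h2, e1])
    refine Quotient.sound ⟨EssIndex.ofMono (a ≫ s) h1, k1, k2, ?_⟩
    have l1 : EssIndex.incl k1 ≫ EssIndex.toDomain s hs = EssIndex.toDomain (a ≫ s) h1 ≫ a := by
      rw [← cancel_mono s, Category.assoc, EssIndex.toDomain_comp, EssIndex.incl_arrow,
        Category.assoc, e1]
    have l2 : EssIndex.incl k2 ≫ EssIndex.toDomain t ht = EssIndex.toDomain (a ≫ s) h1 ≫ b := by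
      rw [← cancel_mono t, Category.assoc, EssIndex.toDomain_comp, EssIndex.incl_arrow,
        Category.assoc, ← h2, e1]
    rw [restrict_apply, restrict_apply, ← Category.assoc, ← Category.assoc, l1, l2,
      Category.assoc, Category.assoc, h3]

theorem SpecHom.exists_mk₂ {A B : C} (φ ψ : SpecHom A B) :
    ∃ (X : C) (s : X ⟶ A) (hs : IsEssentialMono s) (f g : X ⟶ B),
      φ = SpecHom.mk s hs f ∧ ψ = SpecHom.mk s hs g := by
  obtain ⟨i, f, g, rfl, rfl⟩ := DirectLimit.exists_eq_mk₂ _ φ ψ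
  exact ⟨_, _, _, f, g, (SpecHom.mk_arrow i f).symm, (SpecHom.mk_arrow i g).symm⟩

theorem SpecHom.mk_add {X A B : C} (s : X ⟶ A) (hs : IsEssentialMono s) (f g : X ⟶ B) :
    SpecHom.mk s hs (f + g) = SpecHom.mk s hs f + SpecHom.mk s hs g := by
  rw [SpecHom.mk, SpecHom.mk, SpecHom.mk, DirectLimit.add_def, Preadditive.comp_add]

/-- Composition of representatives: `f : X ⟶ B` on `s : X ⟶ A` followed by `g : Y ⟶ D` on
`t : Y ⟶ B` is defined on the inverse image of `Y` under `f`. -/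
noncomputable def SpecHom.compMk {X A B Y D : C} (s : X ⟶ A) (hs : IsEssentialMono s) (f : X ⟶ B)
    (t : Y ⟶ B) (ht : IsEssentialMono t) (g : Y ⟶ D) : SpecHom A D :=
  SpecHom.mk (pullback.fst f t ≫ s) ((ht.pullback_fst f).comp hs) (pullback.snd f t ≫ g)

theorem SpecHom.compMk_eq {X A B Y D Z : C} {s : X ⟶ A} (hs : IsEssentialMono s) (f : X ⟶ B)
    {t : Y ⟶ B} (ht : IsEssentialMono t) (g : Y ⟶ D) (a : Z ⟶ X) (b : Z ⟶ Y)
    (hab : a ≫ f = b ≫ t) (has : IsEssentialMono (a ≫ s)) :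
    SpecHom.compMk s hs f t ht g = SpecHom.mk (a ≫ s) has (b ≫ g) := by
  refine ((SpecHom.mk_eq_mk_iff _ _ _ _).2 ⟨Z, 𝟙 Z, pullback.lift a b hab, ?_, ?_, ?_⟩).symm
  · simpa using has
  · rw [Category.id_comp, pullback.lift_fst_assoc]
  · rw [Category.id_comp, pullback.lift_snd_assoc]

theorem SpecHom.compMk_congr {X X' A B Y Y' D : C} {s : X ⟶ A} (hs : IsEssentialMono s)
    (f : X ⟶ B) {s' : X' ⟶ A} (hs' : IsEssentialMono s') (f' : X' ⟶ B)
    {t : Y ⟶ B} (ht : IsEssentialMono t) (g : Y ⟶ D)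
    {t' : Y' ⟶ B} (ht' : IsEssentialMono t') (g' : Y' ⟶ D)
    (h : SpecHom.mk s hs f = SpecHom.mk s' hs' f')
    (h' : SpecHom.mk t ht g = SpecHom.mk t' ht' g') :
    SpecHom.compMk s hs f t ht g = SpecHom.compMk s' hs' f' t' ht' g' := by
  obtain ⟨Z, a, a', h1, h2, h3⟩ := (SpecHom.mk_eq_mk_iff _ _ _ _).1 h
  obtain ⟨W, b, b', k1, k2, k3⟩ := (SpecHom.mk_eq_mk_iff _ _ _ _).1 h'
  have e1 : IsEssentialMono ((pullback.fst (a ≫ f) (b ≫ t) ≫ a) ≫ s) := by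
    rw [Category.assoc]
    exact (k1.pullback_fst (a ≫ f)).comp h1
  rw [SpecHom.compMk_eq hs f ht g (pullback.fst (a ≫ f) (b ≫ t) ≫ a)
      (pullback.snd (a ≫ f) (b ≫ t) ≫ b) (by simpa using pullback.condition) e1,
    SpecHom.compMk_eq hs' f' ht' g' (pullback.fst (a ≫ f) (b ≫ t) ≫ a')
      (pullback.snd (a ≫ f) (b ≫ t) ≫ b')
      (by rw [Category.assoc, Category.assoc, ← h3, ← k2, pullback.condition])
      (by rw [Category.assoc, ← h2, ← Category.assoc]; exact e1)]
  exact SpecHom.mk_congr _ _ (by rw [Category.assoc, Category.assoc, h2])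
    (by rw [Category.assoc, Category.assoc, k3])

/-- Composition in the spectral category. -/
noncomputable def SpecHom.comp {A B D : C} : SpecHom A B → SpecHom B D → SpecHom A D :=
  Quotient.lift₂
    (fun p q => SpecHom.compMk p.1.sub.arrow p.1.arrow_essential p.2
      q.1.sub.arrow q.1.arrow_essential q.2)
    (fun p q p' q' h h' => SpecHom.compMk_congr _ _ _ _ _ _ _ _
      (by rw [SpecHom.mk_arrow, SpecHom.mk_arrow]; exact Quotient.sound h)
      (by rw [SpecHom.mk_arrow, SpecHom.mk_arrow]; exact Quotient.sound h'))

theorem SpecHom.comp_mk {X A B Y D Z : C} {s : X ⟶ A} (hs : IsEssentialMono s) (f : X ⟶ B)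
    {t : Y ⟶ B} (ht : IsEssentialMono t) (g : Y ⟶ D) (a : Z ⟶ X) (b : Z ⟶ Y)
    (hab : a ≫ f = b ≫ t) (has : IsEssentialMono (a ≫ s)) :
    SpecHom.comp (SpecHom.mk s hs f) (SpecHom.mk t ht g) = SpecHom.mk (a ≫ s) has (b ≫ g) := by
  rw [← SpecHom.compMk_eq hs f ht g a b hab has]
  exact SpecHom.compMk_congr _ _ _ _ _ _ _ _ (SpecHom.mk_arrow _ _) (SpecHom.mk_arrow _ _)

/-- The class of a morphism defined on all of `A`. -/
noncomputable def SpecHom.of {A B : C} (f : A ⟶ B) : SpecHom A B :=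
  SpecHom.mk (𝟙 A) (IsEssentialMono.id A) f

theorem SpecHom.of_comp_mk {A B Y D : C} (f : A ⟶ B) {t : Y ⟶ B} (ht : IsEssentialMono t)
    (g : Y ⟶ D) : SpecHom.comp (SpecHom.of f) (SpecHom.mk t ht g) =
      SpecHom.mk (pullback.fst f t) (ht.pullback_fst f) (pullback.snd f t ≫ g) := by
  rw [SpecHom.of, SpecHom.comp_mk _ f ht g (pullback.fst f t) (pullback.snd f t)
    pullback.condition (by simpa using ht.pullback_fst f)]
  exact SpecHom.mk_congr _ _ (by simp) rfl

theorem SpecHom.mk_comp_of {X A B D : C} {s : X ⟶ A} (hs : IsEssentialMono s) (f : X ⟶ B)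
    (g : B ⟶ D) :
    SpecHom.comp (SpecHom.mk s hs f) (SpecHom.of g) = SpecHom.mk s hs (f ≫ g) := by
  rw [SpecHom.of, SpecHom.comp_mk hs f _ g (𝟙 X) f (by simp) (by simpa using hs)]
  exact SpecHom.mk_congr _ _ (by simp) rfl

theorem SpecHom.of_id_comp {A B : C} (φ : SpecHom A B) :
    SpecHom.comp (SpecHom.of (𝟙 A)) φ = φ := by
  obtain ⟨X, s, hs, f, rfl⟩ := φ.exists_mk
  rw [SpecHom.of, SpecHom.comp_mk _ (𝟙 A) hs f s (𝟙 X) (by simp) (by simpa using hs)]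
  exact SpecHom.mk_congr _ _ (by simp) (by simp)

theorem SpecHom.comp_of_id {A B : C} (φ : SpecHom A B) :
    SpecHom.comp φ (SpecHom.of (𝟙 B)) = φ := by
  obtain ⟨X, s, hs, f, rfl⟩ := φ.exists_mk
  rw [SpecHom.mk_comp_of]
  exact SpecHom.mk_congr _ _ rfl (by simp)

theorem SpecHom.comp_assoc {A B D E : C} (φ : SpecHom A B) (ψ : SpecHom B D) (χ : SpecHom D E) :
    SpecHom.comp (SpecHom.comp φ ψ) χ = SpecHom.comp φ (SpecHom.comp ψ χ) := by
  obtain ⟨X, s, hs, f, rfl⟩ := φ.exists_mk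
  obtain ⟨Y, t, ht, g, rfl⟩ := ψ.exists_mk
  obtain ⟨Z, r, hr, h, rfl⟩ := χ.exists_mk
  have e1 := hr.pullback_fst g
  have e2 := e1.pullback_fst (pullback.snd f t)
  have e3 := ht.pullback_fst f
  rw [SpecHom.comp_mk hs f ht g _ _ pullback.condition (e3.comp hs),
    SpecHom.comp_mk ht g hr h _ _ pullback.condition (e1.comp ht),
    SpecHom.comp_mk (e3.comp hs) (pullback.snd f t ≫ g) hr h
      (pullback.fst (pullback.snd f t) (pullback.fst g r))
      (pullback.snd (pullback.snd f t) (pullback.fst g r) ≫ pullback.snd g r)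
      (by rw [← Category.assoc, pullback.condition, Category.assoc, pullback.condition,
            Category.assoc])
      (e2.comp (e3.comp hs)),
    SpecHom.comp_mk hs f (e1.comp ht) (pullback.snd g r ≫ h)
      (pullback.fst (pullback.snd f t) (pullback.fst g r) ≫ pullback.fst f t)
      (pullback.snd (pullback.snd f t) (pullback.fst g r))
      (by rw [Category.assoc, pullback.condition, ← Category.assoc, pullback.condition,
            Category.assoc])
      (by rw [Category.assoc]; exact e2.comp (e3.comp hs))]
  exact SpecHom.mk_congr _ _ (by simp) (by simp)

theorem SpecHom.add_comp {A B D : C} (φ φ' : SpecHom A B) (ψ : SpecHom B D) :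
    SpecHom.comp (φ + φ') ψ = SpecHom.comp φ ψ + SpecHom.comp φ' ψ := by
  obtain ⟨X, s, hs, f, f', rfl, rfl⟩ := SpecHom.exists_mk₂ φ φ'
  obtain ⟨Y, t, ht, g, rfl⟩ := ψ.exists_mk
  let a := pullback.fst (pullback.fst f t) (pullback.fst f' t) ≫ pullback.fst f t
  let b := pullback.fst (pullback.fst f t) (pullback.fst f' t) ≫ pullback.snd f t
  let b' := pullback.snd (pullback.fst f t) (pullback.fst f' t) ≫ pullback.snd f' t
  have hb : a ≫ f = b ≫ t := by
    simp only [a, b]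
    rw [Category.assoc, Category.assoc, pullback.condition]
  have hb' : a ≫ f' = b' ≫ t := by
    simp only [a, b']
    rw [pullback.condition (f := pullback.fst f t), Category.assoc, Category.assoc,
      pullback.condition]
  have ha : IsEssentialMono (a ≫ s) :=
    (((ht.pullback_fst f').pullback_fst (pullback.fst f t)).comp (ht.pullback_fst f)).comp hs
  rw [← SpecHom.mk_add, SpecHom.comp_mk hs f ht g a b hb ha,
    SpecHom.comp_mk hs f' ht g a b' hb' ha,
    SpecHom.comp_mk hs (f + f') ht g a (b + b')
      (by rw [Preadditive.comp_add, Preadditive.add_comp, hb, hb']) ha,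
    ← SpecHom.mk_add, Preadditive.add_comp]

theorem SpecHom.comp_add {A B D : C} (φ : SpecHom A B) (ψ ψ' : SpecHom B D) :
    SpecHom.comp φ (ψ + ψ') = SpecHom.comp φ ψ + SpecHom.comp φ ψ' := by
  obtain ⟨X, s, hs, f, rfl⟩ := φ.exists_mk
  obtain ⟨Y, t, ht, g, g', rfl, rfl⟩ := SpecHom.exists_mk₂ ψ ψ'
  have e := (ht.pullback_fst f).comp hs
  rw [← SpecHom.mk_add, SpecHom.comp_mk hs f ht g _ _ pullback.condition e,
    SpecHom.comp_mk hs f ht g' _ _ pullback.condition e,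
    SpecHom.comp_mk hs f ht (g + g') _ _ pullback.condition e, ← SpecHom.mk_add,
    Preadditive.comp_add]

end Essential

/-- The objects of the spectral category of `C`: they are the objects of `C`. -/
structure SpectralCategory (C : Type u) : Type u where
  /-- the underlying object of `C` -/
  obj : C

section Category

variable (C : Type u) [Category.{v} C] [Abelian C]

noncomputable instance SpectralCategory.category :
    Category.{max u v} (SpectralCategory C) where
  Hom A B := SpecHom A.obj B.obj
  id A := SpecHom.of (𝟙 A.obj)
  comp φ ψ := SpecHom.comp φ ψ
  id_comp := SpecHom.of_id_comp
  comp_id := SpecHom.comp_of_id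
  assoc := SpecHom.comp_assoc

noncomputable instance SpectralCategory.preadditive : Preadditive (SpectralCategory C) where
  homGroup A B := inferInstanceAs (AddCommGroup (SpecHom A.obj B.obj))
  add_comp _ _ _ := SpecHom.add_comp
  comp_add _ _ _ := SpecHom.comp_add

/-- The canonical functor `P` from `C` to its spectral category. -/
noncomputable def canonicalFunctor : C ⥤ SpectralCategory C where
  obj A := ⟨A⟩
  map f := SpecHom.of f
  map_id _ := rfl
  map_comp f g := (SpecHom.mk_comp_of _ f g).symm

instance : (canonicalFunctor C).Additive where
  map_add {_ _ f g} := SpecHom.mk_add _ _ f g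

end Category

/-- Von Neumann regular rings. -/
def IsVonNeumannRegular (S : Type x) [Ring S] : Prop :=
  ∀ a : S, ∃ b : S, a * b * a = a

/-- `S` is right self-injective: the right `S`-module `S` is injective. Right `S`-modules are
modules over the opposite ring. -/
def IsRightSelfInjective (S : Type x) [Ring S] : Prop :=
  Module.Injective Sᵐᵒᵖ S

end SpectralTheory

/-! For the envelope sequence `0 ⟶ A ⟶ L₀ ⟶ L₁ ⟶ 0`, two extensions of `f` to `L₀` differ by a map
that factors through `L₁`, so the two maps induced on `L₁` differ by a composite `L₁ ⟶ L₀ ⟶ L₁`. This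
vanishes on the inverse image of `A` in `L₁`, which is essential, so the class of `f₁` in the spectral
category is well defined (`map_induced_unique`), and multiplicativity and additivity follow.
A morphism whose class in the spectral category is invertible is an essential monomorphism
(`isEssentialMono_of_isUnit_map`). If this holds for `f` and `f₁`, then `f₀` is an essential
monomorphism out of an injective object, hence invertible, and injectivity of `f₁` forces the inverse
of `f₀` to preserve `A`; so `f` is invertible (`isIso_of_isUnit_map`).

For an arbitrary ring `R`, spectral categories are not needed: vector spaces over the prime fields
suffice. An element `r` is invertible if and only if left multiplication by `r` is bijective on `R`,
and an endomorphism of an abelian group `M` is bijective as soon as it is so on `ℚ ⊗ M`, on the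
`p`-torsion of `M` and on `M / pM` for all primes `p`. Hence the map `primeFieldsHom` from `R` into a
product of endomorphism rings of vector spaces is local. The endomorphism ring of a vector space is
von Neumann regular and, by a short argument with rank one operators, right self-injective
(`isRightSelfInjective_moduleEnd`); both properties pass to products. -/

namespace SpectralTheory

/-! ### Essential monomorphisms and the canonical functor -/

section Essential

variable {C : Type u} [Category.{v} C] [Abelian C]

/-- A morphism whose restriction to an essential subobject is a monomorphism is itself one. -/
theorem mono_of_isEssentialMono_comp {X A B : C} {s : X ⟶ A} (hs : IsEssentialMono s)
    (f : A ⟶ B) (h : Mono (s ≫ f)) : Mono f := by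
  refine Preadditive.mono_of_cancel_zero _ fun {Z} k hk => ?_
  by_contra hk0
  obtain ⟨W, p, t, h1, h2⟩ := ((isEssentialMono_iff s).1 hs).2 Z k hk0
  have ht : t = 0 := by
    rw [← cancel_mono (s ≫ f), ← Category.assoc, ← h1, Category.assoc, hk, comp_zero, zero_comp]
  exact h2 (by rw [h1, ht, zero_comp])

/-- A monomorphism through which an essential monomorphism factors is essential. -/
theorem isEssentialMono_of_comp {X Y A : C} {a : X ⟶ Y} {f : Y ⟶ A}
    (h : IsEssentialMono (a ≫ f)) (hf : Mono f) : IsEssentialMono f := by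
  refine (isEssentialMono_iff f).2 ⟨hf, fun Z k hk => ?_⟩
  obtain ⟨W, p, t, h1, h2⟩ := ((isEssentialMono_iff _).1 h).2 Z k hk
  exact ⟨W, p, t ≫ a, by rw [h1, Category.assoc], h2⟩

/-- An injective object has no proper essential extension. -/
theorem isIso_of_isEssentialMono_of_injective {L M : C} [Injective L] {f : L ⟶ M}
    (hf : IsEssentialMono f) : IsIso f := by
  have := hf.mono
  have hr : f ≫ Injective.factorThru (𝟙 L) f = 𝟙 L := Injective.comp_factorThru _ _
  have : Mono (Injective.factorThru (𝟙 L) f) :=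
    mono_of_isEssentialMono_comp hf _ (by rw [hr]; infer_instance)
  exact ⟨_, hr, by rw [← cancel_mono (Injective.factorThru (𝟙 L) f), Category.assoc, hr,
    Category.comp_id, Category.id_comp]⟩

theorem SpecHom.mk_eq_of_iff {X A B : C} (f : A ⟶ B) {s : X ⟶ A} (hs : IsEssentialMono s)
    (g : X ⟶ B) : SpecHom.mk s hs g = SpecHom.of f ↔
      ∃ (Z : C) (a : Z ⟶ X), IsEssentialMono (a ≫ s) ∧ a ≫ g = (a ≫ s) ≫ f := by
  rw [SpecHom.of, SpecHom.mk_eq_mk_iff]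
  constructor
  · rintro ⟨Z, a, b, h1, h2, h3⟩
    exact ⟨Z, a, h1, by rw [h3, h2, Category.comp_id]⟩
  · rintro ⟨Z, a, h1, h2⟩
    exact ⟨Z, a, a ≫ s, h1, by rw [Category.comp_id], h2⟩

/-- If `P f` has a retraction in the spectral category, then `f` is a monomorphism. -/
theorem mono_of_of_comp_eq_id {A B : C} {f : A ⟶ B} {ψ : SpecHom B A}
    (h : SpecHom.comp (SpecHom.of f) ψ = SpecHom.of (𝟙 A)) : Mono f := by
  obtain ⟨Y, t, ht, g, rfl⟩ := ψ.exists_mk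
  rw [SpecHom.of_comp_mk, SpecHom.mk_eq_of_iff] at h
  obtain ⟨Z, a, h1, h2⟩ := h
  have := h1.mono
  have := ht.mono
  refine mono_of_isEssentialMono_comp h1 f ?_
  have e : (a ≫ pullback.fst f t) ≫ f = (a ≫ pullback.snd f t) ≫ t := by
    rw [Category.assoc, Category.assoc, pullback.condition]
  have : Mono (a ≫ pullback.snd f t) := by
    have : Mono ((a ≫ pullback.snd f t) ≫ g) := by
      rw [Category.assoc, h2, Category.comp_id]
      infer_instance
    exact mono_of_mono _ g
  rw [e]
  infer_instance

/-- If `P f` has a section in the spectral category and `f` is a monomorphism, then `f` is an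
essential monomorphism. -/
theorem isEssentialMono_of_comp_of_eq_id {A B : C} {f : A ⟶ B} (hf : Mono f) {ψ : SpecHom B A}
    (h : SpecHom.comp ψ (SpecHom.of f) = SpecHom.of (𝟙 B)) : IsEssentialMono f := by
  obtain ⟨Y, t, ht, g, rfl⟩ := ψ.exists_mk
  rw [SpecHom.mk_comp_of, SpecHom.mk_eq_of_iff] at h
  obtain ⟨Z, a, h1, h2⟩ := h
  rw [Category.comp_id] at h2
  exact isEssentialMono_of_comp (a := a ≫ g) (by rw [Category.assoc, h2]; exact h1) hf

theorem isEssentialMono_of_isUnit_map {A : C} {f : A ⟶ A}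
    (h : IsUnit (M := End ((canonicalFunctor C).obj A)) ((canonicalFunctor C).map f)) :
    IsEssentialMono f := by
  obtain ⟨⟨p, q, h1, h2⟩, h3⟩ := h
  change p = _ at h3
  subst h3
  exact isEssentialMono_of_comp_of_eq_id (mono_of_of_comp_eq_id h2) h1

/-- A morphism that kills an essential subobject is zero in the spectral category. -/
theorem canonicalFunctor_map_eq_zero {X A B : C} {s : X ⟶ A} (hs : IsEssentialMono s)
    {f : A ⟶ B} (h : s ≫ f = 0) : (canonicalFunctor C).map f = 0 := by
  rw [← (canonicalFunctor C).map_zero]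
  exact (SpecHom.mk_eq_of_iff _ _ _).2 ⟨X, s, by simpa using hs, by simp [h]⟩

end Essential

/-! ### The sequence of an injective envelope -/

section EnvelopeSequence

variable {C : Type u} [Category.{v} C] [Abelian C] {A L₀ L₁ : C} {ι : A ⟶ L₀} {π : L₀ ⟶ L₁}
  {zero : ι ≫ π = 0}

theorem exists_extension (hι : IsInjectiveEnvelope ι) (f : A ⟶ A) :
    ∃ f₀ : L₀ ⟶ L₀, ι ≫ f₀ = f ≫ ι :=
  have := hι.injective
  have := hι.essential.mono
  ⟨Injective.factorThru (f ≫ ι) ι, Injective.comp_factorThru _ _⟩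

theorem existsUnique_induced (hex : (ShortComplex.mk ι π zero).ShortExact) {f : A ⟶ A}
    {f₀ : L₀ ⟶ L₀} (h : ι ≫ f₀ = f ≫ ι) : ∃! f₁ : L₁ ⟶ L₁, π ≫ f₁ = f₀ ≫ π := by
  have : Epi π := hex.epi_g
  have h0 : ι ≫ f₀ ≫ π = 0 := by rw [← Category.assoc, h, Category.assoc, zero, comp_zero]
  refine ⟨hex.exact.desc (f₀ ≫ π) h0, hex.exact.g_desc _ _, fun g hg => ?_⟩
  rw [← cancel_epi π, hg]
  exact (hex.exact.g_desc _ h0).symm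

/-- The class of `f₁` in the spectral category does not depend on the extension `f₀` of `f`: the
difference of two choices of `f₁` has the form `h ≫ π` with `h : L₁ ⟶ L₀`, and it kills the inverse
image of `A` under `h`, an essential subobject of `L₁`. -/
theorem map_induced_unique (hex : (ShortComplex.mk ι π zero).ShortExact)
    (hι : IsInjectiveEnvelope ι) {f : A ⟶ A} {f₀ f₀' : L₀ ⟶ L₀} {f₁ f₁' : L₁ ⟶ L₁}
    (h₀ : ι ≫ f₀ = f ≫ ι) (h₁ : π ≫ f₁ = f₀ ≫ π) (h₀' : ι ≫ f₀' = f ≫ ι)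
    (h₁' : π ≫ f₁' = f₀' ≫ π) :
    (canonicalFunctor C).map f₁ = (canonicalFunctor C).map f₁' := by
  have : Epi π := hex.epi_g
  have h0 : ι ≫ (f₀ - f₀') = 0 := by rw [Preadditive.comp_sub, h₀, h₀', sub_self]
  obtain ⟨h, hh⟩ : ∃ h : L₁ ⟶ L₀, π ≫ h = f₀ - f₀' :=
    ⟨hex.exact.desc _ h0, hex.exact.g_desc _ _⟩
  have hd : f₁ - f₁' = h ≫ π := by
    rw [← cancel_epi π, Preadditive.comp_sub, h₁, h₁', ← Category.assoc, hh,
      Preadditive.sub_comp]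
  rw [← sub_eq_zero, ← Functor.map_sub, hd]
  refine canonicalFunctor_map_eq_zero (hι.essential.pullback_fst h) ?_
  rw [← Category.assoc, pullback.condition, Category.assoc, zero, comp_zero]

/-- `f` is invertible as soon as `P f` and `P f₁` are. The first condition makes `f`, hence `f₀`, an
essential monomorphism, so that `f₀` is an isomorphism by injectivity of `L₀`; the second makes `f₁`
a monomorphism, so that the inverse of `f₀` maps `A` into itself. -/
theorem isIso_of_isUnit_map (hex : (ShortComplex.mk ι π zero).ShortExact)
    (hι : IsInjectiveEnvelope ι) {f : A ⟶ A} {f₀ : L₀ ⟶ L₀} {f₁ : L₁ ⟶ L₁}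
    (h₀ : ι ≫ f₀ = f ≫ ι) (h₁ : π ≫ f₁ = f₀ ≫ π)
    (hf : IsUnit (M := End ((canonicalFunctor C).obj A)) ((canonicalFunctor C).map f))
    (hf₁ : IsUnit (M := End ((canonicalFunctor C).obj L₁)) ((canonicalFunctor C).map f₁)) :
    IsIso f := by
  have := hι.injective
  have := hι.essential.mono
  have := (isEssentialMono_of_isUnit_map hf₁).mono
  have hfe : IsEssentialMono (ι ≫ f₀) := by
    rw [h₀]
    exact (isEssentialMono_of_isUnit_map hf).comp hι.essential
  have : IsIso f₀ := isIso_of_isEssentialMono_of_injective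
    (isEssentialMono_of_comp hfe (mono_of_isEssentialMono_comp hι.essential f₀ hfe.mono))
  have hz : (ι ≫ inv f₀) ≫ π = 0 := by
    rw [← cancel_mono f₁, Category.assoc, Category.assoc, h₁, IsIso.inv_hom_id_assoc, zero,
      zero_comp]
  have hg : hex.exact.lift _ hz ≫ ι = ι ≫ inv f₀ := hex.exact.lift_f _ hz
  refine ⟨hex.exact.lift _ hz, ?_, ?_⟩
  · rw [← cancel_mono ι, Category.assoc]
    erw [hg]
    rw [← Category.assoc, ← h₀, Category.assoc, IsIso.hom_inv_id, Category.comp_id,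
      Category.id_comp]
  · rw [← cancel_mono ι, Category.assoc]
    erw [← h₀]
    rw [← Category.assoc]
    erw [hg]
    rw [Category.assoc, IsIso.inv_hom_id, Category.comp_id, Category.id_comp]

theorem exists_localHom_of_envelope (hex : (ShortComplex.mk ι π zero).ShortExact)
    (hι : IsInjectiveEnvelope ι) :
    ∃ χ : End A →+* End ((canonicalFunctor C).obj A) × End ((canonicalFunctor C).obj L₁),
      (∀ (f : A ⟶ A) (f₀ : L₀ ⟶ L₀) (f₁ : L₁ ⟶ L₁), ι ≫ f₀ = f ≫ ι → π ≫ f₁ = f₀ ≫ π →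
        χ f = ((canonicalFunctor C).map f, (canonicalFunctor C).map f₁)) ∧ IsLocalHom χ := by
  choose e he using exists_extension hι
  choose d hd _ using fun f : A ⟶ A => existsUnique_induced hex (he f)
  have key : ∀ (f : A ⟶ A) (f₀ : L₀ ⟶ L₀) (f₁ : L₁ ⟶ L₁), ι ≫ f₀ = f ≫ ι → π ≫ f₁ = f₀ ≫ π →
      (canonicalFunctor C).map (d f) = (canonicalFunctor C).map f₁ :=
    fun f f₀ f₁ h₀ h₁ => map_induced_unique hex hι (he f) (hd f) h₀ h₁
  let χ : End A →+* End ((canonicalFunctor C).obj A) × End ((canonicalFunctor C).obj L₁) :=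
    { toFun := fun f => ((canonicalFunctor C).map f, (canonicalFunctor C).map (d f))
      map_one' := Prod.ext ((canonicalFunctor C).map_id A)
        ((key (𝟙 A) (𝟙 L₀) (𝟙 L₁) (by simp) (by simp)).trans ((canonicalFunctor C).map_id L₁))
      map_mul' := fun f g => Prod.ext ((canonicalFunctor C).map_comp g f)
        ((key (g ≫ f) (e g ≫ e f) (d g ≫ d f)
          (by rw [← Category.assoc, he, Category.assoc, he, Category.assoc])
          (by rw [← Category.assoc, hd, Category.assoc, hd, Category.assoc])).trans
          ((canonicalFunctor C).map_comp (d g) (d f)))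
      map_zero' := Prod.ext ((canonicalFunctor C).map_zero A A)
        ((key 0 0 0 (by simp) (by simp)).trans ((canonicalFunctor C).map_zero L₁ L₁))
      map_add' := fun f g => Prod.ext ((canonicalFunctor C).map_add (f := f) (g := g))
        ((key (f + g) (e f + e g) (d f + d g)
          (by rw [Preadditive.comp_add, he, he, Preadditive.add_comp])
          (by rw [Preadditive.comp_add, hd, hd, Preadditive.add_comp])).trans
          ((canonicalFunctor C).map_add (f := d f) (g := d g))) }
  refine ⟨χ, fun f f₀ f₁ h₀ h₁ => Prod.ext rfl (key f f₀ f₁ h₀ h₁), ⟨fun f hf => ?_⟩⟩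
  rw [Prod.isUnit_iff] at hf
  exact (isUnit_iff_isIso f).2 (isIso_of_isUnit_map hex hι (he f) (hd f) hf.1 hf.2)

end EnvelopeSequence

/-! ### Regular self-injective rings and products -/

section RegularSelfInjective

/-- Baer's criterion for right ideals: `S` is right self-injective if and only if every
homomorphism from a right ideal of `S` to `S` is a left multiplication. -/
theorem isRightSelfInjective_iff {S : Type x} [Ring S] :
    IsRightSelfInjective S ↔ ∀ (I : Submodule Sᵐᵒᵖ S) (f : I →ₗ[Sᵐᵒᵖ] S),
      ∃ c : S, ∀ a : I, f a = c * a := by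
  constructor
  · intro h I f
    obtain ⟨g, hg⟩ := Module.Injective.out (self := h) I.subtype I.injective_subtype f
    refine ⟨g 1, fun a => ?_⟩
    rw [← hg a, ← MulOpposite.unop_op (a : S), ← op_smul_eq_mul, ← map_smul]
    simp
  · intro h
    let e : S ≃ₗ[Sᵐᵒᵖ] Sᵐᵒᵖ :=
      { MulOpposite.opAddEquiv with map_smul' := fun r s => by simp }
    refine Module.Baer.injective fun I f => ?_
    obtain ⟨c, hc⟩ := h (Submodule.comap e.toLinearMap I)
      (f.comp (e.toLinearMap.restrict (p := Submodule.comap e.toLinearMap I) (q := I) fun _ ha => ha))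
    refine ⟨(LinearMap.toSpanSingleton Sᵐᵒᵖ S c), fun r hr => ?_⟩
    rw [LinearMap.toSpanSingleton_apply]
    exact (hc ⟨r.unop, hr⟩).symm

theorem IsVonNeumannRegular.prod {S T : Type*} [Ring S] [Ring T] (hS : IsVonNeumannRegular S)
    (hT : IsVonNeumannRegular T) : IsVonNeumannRegular (S × T) := fun a => by
  obtain ⟨b, hb⟩ := hS a.1
  obtain ⟨c, hc⟩ := hT a.2
  exact ⟨(b, c), Prod.ext hb hc⟩

theorem IsVonNeumannRegular.pi {α : Type*} {S : α → Type*} [∀ i, Ring (S i)]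
    (hS : ∀ i, IsVonNeumannRegular (S i)) : IsVonNeumannRegular (∀ i, S i) := fun a => by
  choose b hb using fun i => hS i (a i)
  exact ⟨b, funext hb⟩

theorem IsRightSelfInjective.prod {S T : Type x} [Ring S] [Ring T] (hS : IsRightSelfInjective S)
    (hT : IsRightSelfInjective T) : IsRightSelfInjective (S × T) := by
  rw [isRightSelfInjective_iff] at hS hT ⊢
  intro I f
  obtain ⟨c, hc⟩ := hS
    { carrier := {b | (b, 0) ∈ I}
      add_mem' := fun ha hb => by simpa using I.add_mem ha hb
      zero_mem' := I.zero_mem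
      smul_mem' := fun r b hb => by simpa using I.smul_mem (MulOpposite.op (r.unop, 0)) hb }
    { toFun := fun b => (f ⟨(b.1, 0), b.2⟩).1
      map_add' := fun a b => by
        rw [← Prod.fst_add, ← map_add]
        congr 3
        simp
      map_smul' := fun r b => by
        have := congrArg Prod.fst
          (map_smul f (MulOpposite.op (r.unop, (0 : T))) ⟨(b.1, 0), b.2⟩)
        simp only [Prod.fst_mul, op_smul_eq_mul] at this
        rw [RingHom.id_apply, ← MulOpposite.op_unop r, op_smul_eq_mul, ← this]
        congr 3
        simp }
  obtain ⟨d, hd⟩ := hT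
    { carrier := {b | (0, b) ∈ I}
      add_mem' := fun ha hb => by simpa using I.add_mem ha hb
      zero_mem' := I.zero_mem
      smul_mem' := fun r b hb => by simpa using I.smul_mem (MulOpposite.op (0, r.unop)) hb }
    { toFun := fun b => (f ⟨(0, b.1), b.2⟩).2
      map_add' := fun a b => by
        rw [← Prod.snd_add, ← map_add]
        congr 3
        simp
      map_smul' := fun r b => by
        have := congrArg Prod.snd
          (map_smul f (MulOpposite.op ((0 : S), r.unop)) ⟨(0, b.1), b.2⟩)
        simp only [Prod.snd_mul, op_smul_eq_mul] at this
        rw [RingHom.id_apply, ← MulOpposite.op_unop r, op_smul_eq_mul, ← this]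
        congr 3
        simp }
  refine ⟨(c, d), fun a => Prod.ext ?_ ?_⟩
  · have h : (a.1.1, 0) ∈ I := by
      have := I.smul_mem (MulOpposite.op (1, 0)) a.2
      rwa [op_smul_eq_mul, show a.1 * (1, 0) = (a.1.1, 0) from Prod.ext (by simp) (by simp)] at this
    refine Eq.trans ?_ (hc ⟨a.1.1, h⟩)
    have := congrArg Prod.fst (map_smul f (MulOpposite.op ((1 : S), (0 : T))) a)
    simp only [Prod.fst_mul, op_smul_eq_mul, mul_one] at this
    rw [← this]
    change _ = (f ⟨(a.1.1, 0), h⟩).1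
    congr 2
    exact Subtype.ext (Prod.ext (by simp) (by simp))
  · have h : (0, a.1.2) ∈ I := by
      have := I.smul_mem (MulOpposite.op (0, 1)) a.2
      rwa [op_smul_eq_mul, show a.1 * (0, 1) = (0, a.1.2) from Prod.ext (by simp) (by simp)] at this
    refine Eq.trans ?_ (hd ⟨a.1.2, h⟩)
    have := congrArg Prod.snd (map_smul f (MulOpposite.op ((0 : S), (1 : T))) a)
    simp only [Prod.snd_mul, op_smul_eq_mul, mul_one] at this
    rw [← this]
    change _ = (f ⟨(0, a.1.2), h⟩).2
    congr 2
    exact Subtype.ext (Prod.ext (by simp) (by simp))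

theorem IsRightSelfInjective.pi {α : Type*} {S : α → Type*} [∀ i, Ring (S i)]
    (hS : ∀ i, IsRightSelfInjective (S i)) : IsRightSelfInjective (∀ i, S i) := by
  classical
  simp only [isRightSelfInjective_iff] at hS ⊢
  intro I f
  have key : ∀ i, ∃ c : S i, ∀ (b : S i) (hb : Pi.single i b ∈ I), f ⟨_, hb⟩ i = c * b := by
    intro i
    obtain ⟨c, hc⟩ := hS i
      { carrier := {b | Pi.single i b ∈ I}
        add_mem' := fun {a b} ha hb => by
          rw [Set.mem_ofPred_eq, Pi.single_add]
          exact I.add_mem ha hb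
        zero_mem' := by simp
        smul_mem' := fun r b hb => by
          have := I.smul_mem (MulOpposite.op (Pi.single i r.unop)) hb
          rwa [op_smul_eq_mul, ← Pi.single_mul] at this }
      { toFun := fun b => f ⟨Pi.single i b.1, b.2⟩ i
        map_add' := fun a b => by
          rw [← Pi.add_apply, ← map_add]
          exact congrFun (congrArg f (Subtype.ext (Pi.single_add ..))) i
        map_smul' := fun r b => by
          have := congrFun
            (map_smul f (MulOpposite.op (Pi.single i r.unop)) ⟨Pi.single i b.1, b.2⟩) i
          rw [op_smul_eq_mul, Pi.mul_apply, Pi.single_eq_same] at this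
          rw [RingHom.id_apply, ← MulOpposite.op_unop r, op_smul_eq_mul, ← this]
          exact congrFun (congrArg f (Subtype.ext (Pi.single_mul ..))) i }
    exact ⟨c, fun b hb => hc ⟨b, hb⟩⟩
  choose c hc using key
  refine ⟨c, fun a => funext fun i => ?_⟩
  have e : a.1 * Pi.single i 1 = Pi.single i (a.1 i) := by
    rw [← Pi.single_mul_right, mul_one]
  have h : Pi.single i (a.1 i) ∈ I := by
    have := I.smul_mem (MulOpposite.op (Pi.single i 1)) a.2
    rwa [op_smul_eq_mul, e] at this
  rw [Pi.mul_apply, ← hc i _ h]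
  have := congrFun (map_smul f (MulOpposite.op (Pi.single i 1)) a) i
  rw [op_smul_eq_mul, Pi.mul_apply, Pi.single_eq_same, mul_one] at this
  rw [← this]
  exact congrFun (congrArg f (Subtype.ext e)) i

/-! ### Endomorphism rings of vector spaces -/

variable (k : Type*) [Field k] (V : Type x) [AddCommGroup V] [Module k V]

theorem isVonNeumannRegular_moduleEnd : IsVonNeumannRegular (Module.End k V) := fun a => by
  obtain ⟨s, hs⟩ := a.rangeRestrict.exists_rightInverse_of_surjective a.range_rangeRestrict
  obtain ⟨b, hb⟩ := s.exists_extend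
  refine ⟨b, LinearMap.ext fun v => ?_⟩
  have h1 : b (a v) = s (a.rangeRestrict v) := LinearMap.congr_fun hb (a.rangeRestrict v)
  have h2 := congrArg Subtype.val (LinearMap.congr_fun hs (a.rangeRestrict v))
  rw [Module.End.mul_apply, Module.End.mul_apply, h1]
  exact h2

/-- The endomorphism ring of a vector space is right self-injective. For a fixed vector `v₀` and a
functional `φ` with `φ v₀ = 1`, a homomorphism `f` from a right ideal `I` is determined by the map
`w ↦ f (φ · w) v₀` on the subspace of those `w` for which the rank one operator `φ · w` lies in `I`;
any extension of this map to the whole space represents `f`. -/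
theorem isRightSelfInjective_moduleEnd : IsRightSelfInjective (Module.End k V) := by
  rw [isRightSelfInjective_iff]
  intro I f
  rcases subsingleton_or_nontrivial V with hV | hV
  · exact ⟨0, fun a => LinearMap.ext fun v => Subsingleton.elim _ _⟩
  obtain ⟨v₀, hv₀⟩ := exists_ne (0 : V)
  obtain ⟨φ, hφ⟩ := Module.Projective.exists_dual_eq_one k hv₀
  have hsmul (r : k) (w : V) : φ.smulRight (r • w) =
      MulOpposite.op (algebraMap k (Module.End k V) r) • (φ.smulRight w : Module.End k V) := by
    ext v
    simp [smul_smul, mul_comm]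
  let W : Submodule k V :=
    { carrier := {w | (φ.smulRight w : Module.End k V) ∈ I}
      add_mem' := fun {a b} ha hb => by
        have : (φ.smulRight (a + b) : Module.End k V) = φ.smulRight a + φ.smulRight b := by
          ext v
          simp
        rw [Set.mem_ofPred_eq, this]
        exact I.add_mem ha hb
      zero_mem' := by simp
      smul_mem' := fun r w hw => by
        rw [Set.mem_ofPred_eq, hsmul]
        exact I.smul_mem _ hw }
  let g : W →ₗ[k] V :=
    { toFun := fun w => f ⟨φ.smulRight w.1, w.2⟩ v₀
      map_add' := fun a b => by
        rw [← LinearMap.add_apply, ← map_add]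
        congr 2
        refine Subtype.ext (LinearMap.ext fun v => ?_)
        simp
      map_smul' := fun r w => by
        have := LinearMap.congr_fun (map_smul f
          (MulOpposite.op (algebraMap k (Module.End k V) r)) ⟨φ.smulRight w.1, w.2⟩) v₀
        rw [op_smul_eq_mul, Module.End.mul_apply, Module.algebraMap_end_apply, (f _).map_smul]
          at this
        rw [RingHom.id_apply, ← this]
        exact LinearMap.congr_fun (congrArg f (Subtype.ext (hsmul r w))) v₀ }
  obtain ⟨c, hc⟩ := g.exists_extend
  refine ⟨c, fun a => LinearMap.ext fun v => ?_⟩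
  have e : (φ.smulRight (a.1 v) : Module.End k V) =
      MulOpposite.op (φ.smulRight v : Module.End k V) • a.1 := by
    ext u
    simp
  have h : a.1 v ∈ W := by
    change (φ.smulRight (a.1 v) : Module.End k V) ∈ I
    rw [e]
    exact I.smul_mem _ a.2
  have h1 : c (a.1 v) = f ⟨φ.smulRight (a.1 v), h⟩ v₀ := LinearMap.congr_fun hc ⟨a.1 v, h⟩
  have h2 := LinearMap.congr_fun
    (map_smul f (MulOpposite.op (φ.smulRight v : Module.End k V)) a) v₀
  rw [op_smul_eq_mul, Module.End.mul_apply, LinearMap.smulRight_apply, hφ, one_smul] at h2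
  rw [Module.End.mul_apply, h1, ← h2]
  congr 2
  exact Subtype.ext e.symm

end RegularSelfInjective

/-! ### Local morphisms into endomorphism rings over the prime fields -/

section PrimeFields

open TensorProduct

variable (R : Type x) [Ring R]

/-- The part of `R` seen by the prime `p`: the `p`-torsion of `R` together with `R / pR`. Both are
left `R`-modules killed by `p`, so that their product is a vector space over `ZMod p` on which `R`
acts. -/
abbrev PrimePart (p : ℕ) : Type x :=
  LinearMap.ker (p • LinearMap.id : R →ₗ[R] R) ×
    (R ⧸ LinearMap.range (p • LinearMap.id : R →ₗ[R] R))

theorem nsmul_primePart {p : ℕ} (v : PrimePart R p) : p • v = 0 := by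
  obtain ⟨⟨a, ha⟩, b⟩ := v
  induction b using Submodule.Quotient.induction_on with
  | H b =>
    refine Prod.ext (Subtype.ext ha) ?_
    exact (Submodule.Quotient.mk_eq_zero _).2 ⟨b, rfl⟩

instance (p : ℕ) : Module (ZMod p) (PrimePart R p) :=
  AddCommGroup.zmodModule (nsmul_primePart R)

instance (p : ℕ) [NeZero p] : SMulCommClass R (ZMod p) (PrimePart R p) where
  smul_comm r c v := by
    obtain ⟨n, rfl⟩ := ZMod.natCast_zmod_surjective c
    rw [Nat.cast_smul_eq_nsmul, Nat.cast_smul_eq_nsmul, smul_comm]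

instance (p : Nat.Primes) : Fact (p : ℕ).Prime := ⟨p.2⟩

/-- The action of `R` by left multiplication on `ℚ ⊗ R` and, for all primes `p`, on the `p`-torsion
of `R` and on `R / pR`. -/
noncomputable def primeFieldsHom : R →+* Module.End ℚ (ℚ ⊗[ℤ] R) ×
    ∀ p : Nat.Primes, Module.End (ZMod p) (PrimePart R p) :=
  RingHom.prod ((Module.End.baseChangeHom ℤ ℚ R).toRingHom.comp (Module.toModuleEnd ℤ R))
    (RingHom.pi fun p => Module.toModuleEnd (ZMod p) (PrimePart R p))

variable {R}

/-- The equation `r * z = x` is solvable as soon as `r * y = n • x` is, for some `n ≠ 0`. For `n = p`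
prime, injectivity of `r` on `R / pR` gives `y = p • z`, so that `x - r * z` is a `p`-torsion element
and hence a multiple of `r`; the general case follows by factoring `n`. -/
theorem exists_mul_eq_of_mul_eq_nsmul {r : R}
    (h : ∀ p : Nat.Primes, Function.Bijective fun v : PrimePart R p => r • v)
    {n : ℕ} (hn : n ≠ 0) : ∀ {x y : R}, r * y = n • x → ∃ z, r * z = x := by
  induction n using Nat.recOnMul with
  | zero => exact absurd rfl hn
  | one => exact fun {x y} hy => ⟨y, by rw [hy, one_smul]⟩
  | prime p hp =>
    intro x y hy
    let q : Nat.Primes := ⟨p, hp⟩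
    obtain ⟨z, hz⟩ : ∃ z : R, p • z = y := by
      have : ((0, Submodule.Quotient.mk y) : PrimePart R q) = 0 := by
        apply (h q).1
        refine Prod.ext (by simp) ?_
        change r • Submodule.Quotient.mk y = r • 0
        rw [smul_zero, ← Submodule.Quotient.mk_smul, Submodule.Quotient.mk_eq_zero, smul_eq_mul, hy]
        exact ⟨x, rfl⟩
      exact (Submodule.Quotient.mk_eq_zero _).1 (congrArg Prod.snd this)
    have ht : x - r * z ∈ LinearMap.ker (p • LinearMap.id : R →ₗ[R] R) := by
      change p • (x - r * z) = 0
      rw [smul_sub, ← hy, ← mul_smul_comm, hz, sub_self]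
    obtain ⟨⟨⟨t, _⟩, _⟩, hv⟩ := (h q).2 ((⟨_, ht⟩, 0) : PrimePart R q)
    have : r * t = x - r * z := congrArg (fun v : PrimePart R q => (v.1 : R)) hv
    exact ⟨t + z, by rw [mul_add, this, sub_add_cancel]⟩
  | mul a b iha ihb =>
    intro x y hy
    rw [mul_smul] at hy
    obtain ⟨z, hz⟩ := iha (left_ne_zero_of_mul hn) hy
    exact ihb (right_ne_zero_of_mul hn) hz

/-- Injectivity of `r` on the `p`-torsion for all primes `p` gives injectivity on all torsion. -/
theorem eq_zero_of_mul_eq_zero_of_nsmul {r : R}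
    (h : ∀ p : Nat.Primes, Function.Bijective fun v : PrimePart R p => r • v)
    {n : ℕ} (hn : n ≠ 0) : ∀ {x : R}, r * x = 0 → n • x = 0 → x = 0 := by
  induction n using Nat.recOnMul with
  | zero => exact absurd rfl hn
  | one => exact fun {x} _ hx => by rwa [one_smul] at hx
  | prime p hp =>
    intro x hx hpx
    let q : Nat.Primes := ⟨p, hp⟩
    have : ((⟨x, hpx⟩, 0) : PrimePart R q) = 0 :=
      (h q).1 (Prod.ext (Subtype.ext (by simpa using hx)) (by simp))
    exact congrArg (fun v : PrimePart R q => (v.1 : R)) this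
  | mul a b iha ihb =>
    intro x hx hnx
    refine ihb (right_ne_zero_of_mul hn) hx (iha (left_ne_zero_of_mul hn) ?_ ?_)
    · rw [mul_smul_comm, hx, smul_zero]
    · rwa [← mul_smul]

/-- An element of `R` that acts bijectively on `ℚ ⊗ R`, on the `p`-torsion of `R` and on `R / pR`
for all primes `p` acts bijectively on `R`, so it is invertible. -/
instance isLocalHom_primeFieldsHom : IsLocalHom (primeFieldsHom R) where
  map_nonunit r hr := by
    obtain ⟨h0, hp⟩ := Prod.isUnit_iff.1 hr
    replace hp : ∀ p : Nat.Primes, Function.Bijective fun v : PrimePart R p => r • v :=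
      fun p => (Module.End.isUnit_iff _).1 (Pi.isUnit_iff.1 hp p)
    replace h0 : Function.Bijective ((LinearMap.mulLeft ℤ r).baseChange ℚ) :=
      (Module.End.isUnit_iff _).1 h0
    -- `1 ⊗ x = 0` in `ℚ ⊗ R` if and only if `x` is a torsion element
    have tor {x : R} (hx : (1 : ℚ) ⊗ₜ[ℤ] x = 0) : ∃ n : ℕ, n ≠ 0 ∧ n • x = 0 := by
      obtain ⟨⟨m, hm⟩, hmx⟩ := (IsLocalizedModule.eq_zero_iff (nonZeroDivisors ℤ)
        (TensorProduct.mk ℤ ℚ R 1)).1 hx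
      refine ⟨m.natAbs, Int.natAbs_ne_zero.2 (nonZeroDivisors.ne_zero hm), ?_⟩
      rwa [natAbs_nsmul_eq_zero]
    have inj {x : R} (hx : r * x = 0) : x = 0 := by
      have : (1 : ℚ) ⊗ₜ[ℤ] x = 0 := h0.1 (by simp [hx])
      obtain ⟨n, hn, hnx⟩ := tor this
      exact eq_zero_of_mul_eq_zero_of_nsmul hp hn hx hnx
    obtain ⟨s, hs⟩ : ∃ s, r * s = 1 := by
      obtain ⟨t, ht⟩ := h0.2 ((1 : ℚ) ⊗ₜ[ℤ] (1 : R))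
      obtain ⟨⟨y, m⟩, hm⟩ := IsLocalizedModule.surj (nonZeroDivisors ℤ)
        (TensorProduct.mk ℤ ℚ R 1) t
      have h1 : (1 : ℚ) ⊗ₜ[ℤ] (r * y - (m : ℤ) • (1 : R)) = 0 := by
        have h2 : (m : ℤ) • (LinearMap.mulLeft ℤ r).baseChange ℚ t = 1 ⊗ₜ[ℤ] (r * y) := by
          rw [← map_zsmul]
          exact congrArg ((LinearMap.mulLeft ℤ r).baseChange ℚ) hm
        rw [TensorProduct.tmul_sub, ← h2, ht, TensorProduct.tmul_smul, sub_self]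
      obtain ⟨n, hn, hny⟩ := tor h1
      -- the factor `sign m` replaces the integer `m` by the natural number `|m|`
      refine exists_mul_eq_of_mul_eq_nsmul hp
        (mul_ne_zero hn (Int.natAbs_ne_zero.2 (nonZeroDivisors.ne_zero m.2)))
        (y := (m : ℤ).sign • n • y) ?_
      rw [smul_sub, sub_eq_zero] at hny
      rw [mul_smul_comm, mul_smul_comm, hny, mul_smul, smul_comm _ n, smul_smul,
        Int.sign_mul_self_eq_natAbs, natCast_zsmul]
    exact ⟨⟨r, s, hs, sub_eq_zero.1 (inj (by rw [mul_sub, ← mul_assoc, hs, one_mul, mul_one,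
      sub_self]))⟩, rfl⟩

/-- Every ring has a local morphism into a product of endomorphism rings of vector spaces. -/
theorem exists_localHom_regular_selfInjective :
    ∃ (S : Type x) (_ : Ring S) (φ : R →+* S),
      IsVonNeumannRegular S ∧ IsRightSelfInjective S ∧ IsLocalHom φ :=
  ⟨_, inferInstance, primeFieldsHom R,
    (isVonNeumannRegular_moduleEnd _ _).prod (.pi fun _ => isVonNeumannRegular_moduleEnd _ _),
    (isRightSelfInjective_moduleEnd _ _).prod (.pi fun _ => isRightSelfInjective_moduleEnd _ _),
    inferInstance⟩

end PrimeFields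

end SpectralTheory

theorem theorem5p3 :
    -- `0 ⟶ A ⟶ L₀ ⟶ L₁ ⟶ 0` exact, with `A ⟶ L₀` an injective envelope
    (∀ (C : Type u) [Category.{v} C] [Abelian C] [IsGrothendieckAbelian.{w} C]
      (A L₀ L₁ : C) (ι : A ⟶ L₀) (π : L₀ ⟶ L₁) (zero : ι ≫ π = 0),
      (ShortComplex.mk ι π zero).ShortExact → SpectralTheory.IsInjectiveEnvelope ι →
      -- every `f` extends to some `f₀`, and every extension `f₀` induces a unique `f₁`
      (∀ f : A ⟶ A, ∃ f₀ : L₀ ⟶ L₀, ι ≫ f₀ = f ≫ ι) ∧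
      (∀ (f : A ⟶ A) (f₀ : L₀ ⟶ L₀), ι ≫ f₀ = f ≫ ι → ∃! f₁ : L₁ ⟶ L₁, π ≫ f₁ = f₀ ≫ π) ∧
      -- `f ↦ (P f, P f₁)` is well defined, a ring morphism, and local
      ∃ χ : End A →+*
          End ((SpectralTheory.canonicalFunctor C).obj A) ×
            End ((SpectralTheory.canonicalFunctor C).obj L₁),
        (∀ (f : A ⟶ A) (f₀ : L₀ ⟶ L₀) (f₁ : L₁ ⟶ L₁),
          ι ≫ f₀ = f ≫ ι → π ≫ f₁ = f₀ ≫ π →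
          χ f = ((SpectralTheory.canonicalFunctor C).map f,
            (SpectralTheory.canonicalFunctor C).map f₁)) ∧
        IsLocalHom χ) ∧
    (∀ (R : Type x) [Ring R], ∃ (S : Type x) (_ : Ring S) (φ : R →+* S),
      SpectralTheory.IsVonNeumannRegular S ∧ SpectralTheory.IsRightSelfInjective S ∧
        IsLocalHom φ) := by

  refine ⟨fun C _ _ _ A L₀ L₁ ι π zero hex hι => ?_, fun R _ => ?_⟩
  · exact ⟨SpectralTheory.exists_extension hι,
      fun f f₀ h => SpectralTheory.existsUnique_induced hex h,
      SpectralTheory.exists_localHom_of_envelope hex hι⟩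
  · exact SpectralTheory.exists_localHom_regular_selfInjective
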